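/- Subtraction on $[0,\infty]$ is truncated: $a\ominus b=\max\{a-b,0\}$, with $\infty\ominus\infty=0$ and $\infty\ominus a=\infty$ for $a<\infty$. A metric space is a set $X$ with a map $d:X\times X\to[0,\infty]$ such that $d(x,x)=0$ and $d(x,z)\le d(x,y)+d(y,z)$. A map $f:(X,d_X)\to(Y,d_Y)$ is non-expansive if $d_Y(f(x),f(y))\le d_X(x,y)$ for all $x,y\in X$; metric spaces and non-expansive maps form the category $\mathsf{Met}$. A net $(x_i)_i$ in $(X,d)$ is forward Cauchy if $\inf_i\sup_{k\ge j\ge i}d(x_j,x_k)=0$; a point $x$ is a Yoneda limit of it if $d(x,y)=\inf_i\sup_{j\ge i}d(x_j,y)$ for all $y\in X$. A non-expansive map $f$ is Yoneda continuous if, whenever $x$ is a Yoneda limit of a forward Cauchy net $(x_i)_i$, the point $f(x)$ is a Yoneda limit of $(f(x_i))_i$. Metric spaces and Yoneda continuous maps form the category $\mathsf{Met}^\uparrow$. Let $d_R(x,y)=x\ominus y$ on $[0,\infty]$; the power $([0,\infty],d_R)^I$ is $[0,\infty]^I$ with the metric $\sup_{i\in I}d_R(x_i,y_i)$. An approach space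 is a set $X$ with a map $\delta:X\times 2^X\to[0,\infty]$ such that, for all $x\in X$ and $A,B\subseteq X$: $\delta(x,\{x\})=0$; $\delta(x,\varnothing)=\infty$; $\delta(x,A\cup B)=\min\{\delta(x,A),\delta(x,B)\}$; $\delta(x,A)\le\delta(x,B)+\sup_{b\in B}\delta(b,A)$. A contraction $f:(X,\delta_X)\to(Y,\delta_Y)$ is a map with $\delta_Y(f(x),f(A))\le\delta_X(x,A)$ for all $x\in X$ and $A\subseteq X$, and it is an embedding if equality always holds. Approach spaces and contractions form the category $\mathsf{App}$. An approach space is $T_0$ if $\delta(x,\{y\})=\delta(y,\{x\})=0$ implies $x=y$. A $T_0$ approach space $Z$ is injective if for every embedding $e:X\to Y$ of approach spaces and every contraction $f:X\to Z$ there is a contraction $f^*:Y\to Z$ with $f^*\circ e=f$. The functor $\Omega:\mathsf{App}\to\mathsf{Met}$ sends $(X,\delta)$ to $X$ with the metric $(x,y)\mapsto\delta(x,\{y\})$, and is the identity on underlying maps. A Scott weight of a metric space $(X,d)$ is a function $\phi:X\to[0,\infty]$ such that $\phi(x)\le\phi(y)+d(x,y)$ for all $x,y\in X$, and $\phi(x)\le\inf_i\sup_{j\ge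 i}\phi(x_j)$ for every forward Cauchy net $(x_i)_i$ and every Yoneda limit $x$ of it. The functor $\Sigma:\mathsf{Met}^\uparrow\to\mathsf{App}$ sends $(X,d)$ to $X$ with the Scott distance $$\sigma(x,A)=\sup\{\phi(x)\mid \phi\text{ is a Scott weight of }(X,d)\text{ and }\phi(a)=0\text{ for all }a\in A\},$$ and is the identity on underlying maps. **Theorem.** Let $\mathsf{C}$ be the full subcategory of $\mathsf{Met}^\uparrow$ whose objects are the retracts, in $\mathsf{Met}^\uparrow$, of powers of $([0,\infty],d_R)$, and let $\mathsf{InjApp}$ be the full subcategory of $\mathsf{App}$ of injective $T_0$ approach spaces. Then $\Sigma$ restricts to a functor $\mathsf{C}\to\mathsf{InjApp}$; $\Omega$ restricts to a functor $\mathsf{InjApp}\to\mathsf{C}$ (in particular, $\Omega$ sends contractions between injective $T_0$ approach spaces to Yoneda continuous maps); and these two functors are inverse to each other. Hence $\mathsf{InjApp}$ and $\mathsf{C}$ are isomorphic categories. -/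

import Mathlib

open CategoryTheory
open scoped ENNReal

universe u

namespace ScottApproach

/-! ## Metric spaces in the sense of Lawvere -/

/-- A metric on `X`: neither symmetry, nor finiteness, nor separation is required. -/
@[ext]
structure Metric (X : Type u) where
  dist : X → X → ℝ≥0∞
  dist_self : ∀ x, dist x x = 0
  dist_triangle : ∀ x y z, dist x z ≤ dist x y + dist y z

/-- Non-expansive maps between metric spaces. -/
def IsNonexpansive {X Y : Type u} (dX : Metric X) (dY : Metric Y) (f : X → Y) : Prop :=
  ∀ x y, dY.dist (f x) (f y) ≤ dX.dist x y

/-- Forward Cauchy nets: `inf_i sup_{k ≥ j ≥ i} d(x_j, x_k) = 0`. -/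
def IsForwardCauchy {X : Type u} (d : Metric X) {I : Type u} [Preorder I] (x : I → X) : Prop :=
  (⨅ i, ⨆ j, ⨆ (_ : i ≤ j), ⨆ k, ⨆ (_ : j ≤ k), d.dist (x j) (x k)) = 0

/-- `a` is a Yoneda limit of the net `x`: `d(a, y) = inf_i sup_{j ≥ i} d(x_j, y)` for all `y`. -/
def IsYonedaLimit {X : Type u} (d : Metric X) {I : Type u} [Preorder I] (x : I → X) (a : X) :
    Prop :=
  ∀ y, d.dist a y = ⨅ i, ⨆ j, ⨆ (_ : i ≤ j), d.dist (x j) y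

/-- Yoneda continuous maps: non-expansive maps preserving Yoneda limits of forward Cauchy nets. -/
structure IsYonedaContinuous {X Y : Type u} (dX : Metric X) (dY : Metric Y) (f : X → Y) :
    Prop where
  nonexpansive : IsNonexpansive dX dY f
  map_limit : ∀ (I : Type u) [Preorder I] [IsDirectedOrder I] [Nonempty I] (x : I → X) (a : X),
    IsForwardCauchy dX x → IsYonedaLimit dX x a → IsYonedaLimit dY (fun i => f (x i)) (f a)

/-- Metric spaces. -/
structure Met : Type (u + 1) where
  carrier : Type u
  metric : Metric carrier

/-- The category of metric spaces and non-expansive maps. -/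
instance : Category.{u} Met.{u} where
  Hom X Y := {f : X.carrier → Y.carrier // IsNonexpansive X.metric Y.metric f}
  id X := ⟨id, fun _ _ => le_rfl⟩
  comp f g := ⟨g.1 ∘ f.1, fun x y => (g.2 _ _).trans (f.2 x y)⟩

/-- The objects of `Met^↑`: again all metric spaces, but with a different notion of morphism. -/
structure MetUp : Type (u + 1) where
  carrier : Type u
  metric : Metric carrier

/-- The category `Met^↑` of metric spaces and Yoneda continuous maps. -/
instance : Category.{u} MetUp.{u} where
  Hom X Y := {f : X.carrier → Y.carrier // IsYonedaContinuous X.metric Y.metric f}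
  id X := ⟨id, fun _ _ => le_rfl, fun _ _ _ _ _ _ _ h => h⟩
  comp {X Y Z} f g := ⟨g.1 ∘ f.1,
    { nonexpansive := fun x y => (g.2.nonexpansive _ _).trans (f.2.nonexpansive x y)
      map_limit := fun I _ _ _ x a hx ha => by
        refine g.2.map_limit I (fun i => f.1 (x i)) (f.1 a) ?_ (f.2.map_limit I x a hx ha)
        refine le_antisymm (le_trans ?_ (le_of_eq hx)) bot_le
        exact iInf_mono fun i => iSup_mono fun j => iSup_mono fun _ => iSup_mono fun k =>
          iSup_mono fun _ => f.2.nonexpansive _ _ }⟩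

/-- The inclusion functor of `Met^↑` into `Met`. -/
def metUpToMet : MetUp.{u} ⥤ Met.{u} where
  obj X := ⟨X.carrier, X.metric⟩
  map f := ⟨f.1, f.2.nonexpansive⟩

/-- The metric `d_R(x, y) = x ⊖ y = max (x - y) 0` on `[0, ∞]`; subtraction on `ℝ≥0∞` is truncated,
with `∞ - ∞ = 0` and `∞ - a = ∞` for `a < ∞`. -/
def dR : Metric ℝ≥0∞ where
  dist x y := x - y
  dist_self x := tsub_self x
  dist_triangle _ _ _ := tsub_le_tsub_add_tsub

/-- The power `([0, ∞], d_R)^I`, with the sup-metric of a product of metric spaces. -/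
noncomputable def dRPower (I : Type u) : MetUp.{u} where
  carrier := I → ℝ≥0∞
  metric :=
    { dist := fun x y => ⨆ i, dR.dist (x i) (y i)
      dist_self := fun x => by simp [dR.dist_self]
      dist_triangle := fun x y z => iSup_le fun i =>
        (dR.dist_triangle (x i) (y i) (z i)).trans
          (add_le_add (le_iSup (fun i => dR.dist (x i) (y i)) i)
            (le_iSup (fun i => dR.dist (y i) (z i)) i)) }

/-- Metric spaces that are a retract, in `Met^↑`, of some power of `([0, ∞], d_R)`. -/
def IsRetractOfPower : ObjectProperty MetUp.{u} := fun X =>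
  ∃ I : Type u, Nonempty (Retract X (dRPower I))

/-! ## Approach spaces -/

/-- An approach distance on `X`. -/
@[ext]
structure ApproachDistance (X : Type u) where
  dist : X → Set X → ℝ≥0∞
  dist_singleton_self : ∀ x, dist x {x} = 0
  dist_empty : ∀ x, dist x ∅ = ∞
  dist_union : ∀ x A B, dist x (A ∪ B) = min (dist x A) (dist x B)
  dist_triangle : ∀ x A B, dist x A ≤ dist x B + ⨆ b ∈ B, dist b A

/-- Contractions between approach spaces. -/
def IsContraction {X Y : Type u} (δX : ApproachDistance X) (δY : ApproachDistance Y) (f : X → Y) :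
    Prop :=
  ∀ x A, δY.dist (f x) (f '' A) ≤ δX.dist x A

/-- Approach spaces. -/
structure App : Type (u + 1) where
  carrier : Type u
  approach : ApproachDistance carrier

/-- The category of approach spaces and contractions. -/
instance : Category.{u} App.{u} where
  Hom X Y := {f : X.carrier → Y.carrier // IsContraction X.approach Y.approach f}
  id X := ⟨id, fun x A => by rw [Set.image_id]; exact le_rfl⟩
  comp f g := ⟨g.1 ∘ f.1, fun x A => by
    rw [Set.image_comp]; exact (g.2 _ _).trans (f.2 x A)⟩

/-- `T_0` approach spaces. -/
def IsT0 (X : App.{u}) : Prop :=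
  ∀ x y, X.approach.dist x {y} = 0 → X.approach.dist y {x} = 0 → x = y

/-- Embeddings of approach spaces. -/
def IsEmbedding {X Y : App.{u}} (e : X ⟶ Y) : Prop :=
  ∀ x A, X.approach.dist x A = Y.approach.dist (e.1 x) (e.1 '' A)

/-- Injective `T_0` approach spaces: contractions into them extend along all embeddings. -/
def IsInjectiveT0 : ObjectProperty App.{u} := fun Z =>
  IsT0 Z ∧ ∀ (X Y : App.{u}) (e : X ⟶ Y) (f : X ⟶ Z), IsEmbedding e → ∃ g : Y ⟶ Z, e ≫ g = f

/-- The functor `Ω : App ⥤ Met` sending an approach space to its specialization metric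
`(x, y) ↦ δ(x, {y})`, and a contraction to itself. -/
def OmegaFunctor : App.{u} ⥤ Met.{u} where
  obj X :=
    { carrier := X.carrier
      metric :=
        { dist := fun x y => X.approach.dist x {y}
          dist_self := X.approach.dist_singleton_self
          dist_triangle := fun x y z => by
            simpa using X.approach.dist_triangle x {z} {y} } }
  map f := ⟨f.1, fun x y => by simpa using f.2 x {y}⟩

/-! ## The Scott distance -/

/-- Weights of a metric space. -/
def IsWeight {X : Type u} (d : Metric X) (φ : X → ℝ≥0∞) : Prop :=
  ∀ x y, φ x ≤ φ y + d.dist x y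

/-- Scott weights of a metric space. -/
structure IsScottWeight {X : Type u} (d : Metric X) (φ : X → ℝ≥0∞) : Prop where
  weight : IsWeight d φ
  le_limit : ∀ (I : Type u) [Preorder I] [IsDirectedOrder I] [Nonempty I] (x : I → X) (a : X),
    IsForwardCauchy d x → IsYonedaLimit d x a → φ a ≤ ⨅ i, ⨆ j, ⨆ (_ : i ≤ j), φ (x j)

theorem isScottWeight_top {X : Type u} (d : Metric X) : IsScottWeight d fun _ => ∞ where
  weight _ _ := by simp
  le_limit I _ _ _ x a _ _ := le_iInf fun i =>
    le_iSup_of_le i (le_iSup_of_le le_rfl le_rfl)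

theorem IsScottWeight.eventually_lt {X : Type u} {d : Metric X} {φ : X → ℝ≥0∞}
    (h : IsScottWeight d φ) {I : Type u} [Preorder I] [IsDirectedOrder I] [Nonempty I] {x : I → X}
    {a : X} (hx : IsForwardCauchy d x) (ha : IsYonedaLimit d x a) {c : ℝ≥0∞} (hc : c < φ a) :
    ∃ i, ∀ j, i ≤ j → c < φ (x j) := by
  obtain ⟨b, hcb, hb⟩ := exists_between hc
  have hcb' : 0 < b - c := tsub_pos_of_lt hcb
  unfold IsForwardCauchy at hx
  rw [← hx, iInf_lt_iff] at hcb'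
  obtain ⟨i, hi⟩ := hcb'
  have h1 := (hb.trans_le (h.le_limit I x a hx ha)).trans_le (iInf_le _ i)
  simp only [lt_iSup_iff] at h1
  obtain ⟨j, hij, hj⟩ := h1
  refine ⟨j, fun k hjk => ?_⟩
  have h2 : d.dist (x j) (x k) < b - c := lt_of_le_of_lt
    (le_trans (le_iSup₂_of_le k hjk le_rfl) (le_iSup₂ (f := fun j (_ : i ≤ j) =>
      ⨆ k, ⨆ (_ : j ≤ k), d.dist (x j) (x k)) j hij)) hi
  by_contra hk
  have h3 : φ (x j) ≤ b := calc
    φ (x j) ≤ φ (x k) + d.dist (x j) (x k) := h.weight _ _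
    _ ≤ c + (b - c) := add_le_add (not_lt.1 hk) h2.le
    _ = b := add_tsub_cancel_of_le hcb.le
  exact absurd hj (not_lt.2 h3)

theorem IsScottWeight.min {X : Type u} {d : Metric X} {φ ψ : X → ℝ≥0∞}
    (hφ : IsScottWeight d φ) (hψ : IsScottWeight d ψ) :
    IsScottWeight d fun x => min (φ x) (ψ x) where
  weight x y := by
    change Min.min (φ x) (ψ x) ≤ Min.min (φ y) (ψ y) + d.dist x y
    rw [← min_add_add_right]
    exact min_le_min (hφ.weight x y) (hψ.weight x y)
  le_limit I _ _ _ x a hx ha := by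
    refine le_iInf fun i => le_of_forall_lt fun c hc => ?_
    obtain ⟨i₁, h₁⟩ := hφ.eventually_lt hx ha (hc.trans_le (min_le_left _ _))
    obtain ⟨i₂, h₂⟩ := hψ.eventually_lt hx ha (hc.trans_le (min_le_right _ _))
    obtain ⟨j, hj₁, hj₂⟩ := exists_ge_ge i₁ i₂
    obtain ⟨k, hk, hjk⟩ := exists_ge_ge i j
    exact (lt_min (h₁ k (hj₁.trans hjk)) (h₂ k (hj₂.trans hjk))).trans_le
      (le_iSup_of_le k (le_iSup_of_le hk le_rfl))

theorem IsScottWeight.tsub {X : Type u} {d : Metric X} {φ : X → ℝ≥0∞}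
    (hφ : IsScottWeight d φ) (r : ℝ≥0∞) : IsScottWeight d fun x => φ x - r where
  weight x y := by
    rw [tsub_le_iff_right]
    calc φ x ≤ φ y + d.dist x y := hφ.weight x y
      _ ≤ (φ y - r + r) + d.dist x y := add_le_add_left le_tsub_add _
      _ = φ y - r + d.dist x y + r := add_right_comm _ _ _
  le_limit I _ _ _ x a hx ha := by
    refine le_iInf fun i => ?_
    rw [tsub_le_iff_right]
    refine (hφ.le_limit I x a hx ha).trans ((iInf_le _ i).trans ?_)
    exact iSup_le fun j => iSup_le fun hj => le_tsub_add.trans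
      (add_le_add_left (le_iSup₂ (f := fun j (_ : i ≤ j) => φ (x j) - r) j hj) r)

/-- The Scott distance of a metric space: `σ(x, A)` is the supremum of `φ x` over all Scott weights
`φ` that vanish on `A`. -/
noncomputable def scottDistance {X : Type u} (d : Metric X) : ApproachDistance X where
  dist x A := ⨆ φ : X → ℝ≥0∞, ⨆ (_ : IsScottWeight d φ), ⨆ (_ : ∀ a ∈ A, φ a = 0), φ x
  dist_singleton_self x := by
    refine le_antisymm ?_ bot_le
    exact iSup_le fun φ => iSup_le fun _ => iSup_le fun h => (h x rfl).le
  dist_empty x := by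
    refine le_antisymm le_top ?_
    exact le_iSup_of_le (fun _ => ∞) (le_iSup_of_le (isScottWeight_top d)
      (le_iSup_of_le (by simp) le_rfl))
  dist_union x A B := by
    refine le_antisymm (le_min ?_ ?_) ?_
    · exact iSup_mono fun φ => iSup_mono fun _ => iSup_le fun h =>
        le_iSup_of_le (fun a ha => h a (Or.inl ha)) le_rfl
    · exact iSup_mono fun φ => iSup_mono fun _ => iSup_le fun h =>
        le_iSup_of_le (fun a ha => h a (Or.inr ha)) le_rfl
    · refine le_of_forall_lt fun c hc => ?_
      rw [lt_min_iff] at hc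
      simp only [lt_iSup_iff] at hc
      obtain ⟨⟨φ, hφ, hA, hcφ⟩, ψ, hψ, hB, hcψ⟩ := hc
      refine (lt_min hcφ hcψ).trans_le (le_iSup_of_le _ (le_iSup_of_le (hφ.min hψ)
        (le_iSup_of_le ?_ le_rfl)))
      rintro a (ha | ha)
      · simp [hA a ha]
      · simp [hB a ha]
  dist_triangle x A B := by
    refine iSup_le fun φ => iSup_le fun hφ => iSup_le fun hA => ?_
    rw [← tsub_le_iff_right]
    refine le_iSup_of_le _ (le_iSup_of_le (hφ.tsub _) (le_iSup_of_le ?_ le_rfl))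
    intro b hb
    refine tsub_eq_zero_of_le ?_
    exact le_iSup_of_le b (le_iSup_of_le hb (le_iSup_of_le φ (le_iSup_of_le hφ
      (le_iSup_of_le hA le_rfl))))

/-- The functor `Σ : Met^↑ ⥤ App` equipping a metric space with its Scott distance, and sending a
Yoneda continuous map to itself. -/
noncomputable def SigmaFunctor : MetUp.{u} ⥤ App.{u} where
  obj X := ⟨X.carrier, scottDistance X.metric⟩
  map {X Y} f := ⟨f.1, fun x A => by
    refine iSup_le fun φ => iSup_le fun hφ => iSup_le fun hA => ?_
    have hs : IsScottWeight X.metric (φ ∘ f.1) :=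
      { weight := fun x y =>
          (hφ.weight _ _).trans (add_le_add_right (f.2.nonexpansive x y) _)
        le_limit := fun I _ _ _ x a hx ha => by
          refine hφ.le_limit I (fun i => f.1 (x i)) (f.1 a) ?_ (f.2.map_limit I x a hx ha)
          refine le_antisymm (le_trans ?_ (le_of_eq hx)) bot_le
          exact iInf_mono fun i => iSup_mono fun j => iSup_mono fun _ => iSup_mono fun k =>
            iSup_mono fun _ => f.2.nonexpansive _ _ }
    exact le_iSup_of_le (φ ∘ f.1) (le_iSup_of_le hs
      (le_iSup_of_le (fun a ha => hA _ ⟨a, ha, rfl⟩) le_rfl))⟩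

/-- The category of injective `T_0` approach spaces and contractions. -/
abbrev InjApp : Type (u + 1) := (IsInjectiveT0.{u}).FullSubcategory

/-- The full subcategory of `Met^↑` of retracts of powers of `([0, ∞], d_R)`. -/
abbrev RetrMet : Type (u + 1) := (IsRetractOfPower.{u}).FullSubcategory

end ScottApproach

/-! Everything is tested on regular functions, the contractions to `[0, ∞]`. For a Scott distance
they are exactly the Scott weights, and a map into a power of `[0, ∞]` is a contraction iff its
coordinates are regular (`isContraction_dRMetric_iff`): `Σ` of a power is the product in `App`.
Regular functions extend along embeddings, so these products are injective; evaluation at all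
regular functions embeds any approach space into one. Hence every injective `T_0` space is a retract
in `App` of `Σ` of a power, and `Σ`, being a functor, sends retracts of powers to injective spaces.

Conversely, contractions between Scott distances are Yoneda continuous. A retraction onto `Z` in
`App` therefore gives a Yoneda continuous idempotent on the power, which splits in `Met^↑` through
the specialization metric of `Z`. Both `Z` and `ΣΩZ` then carry the distance induced along the same
section, so they are equal; `ΩΣ = id` holds for every metric space. -/

namespace ScottApproach

/-! ## Regular functions -/

/-- Regular functions of an approach space: the contractions to `[0, ∞]` with the distance
`(x, A) ↦ x ⊖ sup A` (and `∞` for empty `A`). -/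
def ApproachDistance.IsRegular {Z : Type u} (δ : ApproachDistance Z) (h : Z → ℝ≥0∞) : Prop :=
  ∀ z A, h z ≤ (⨆ a ∈ A, h a) + δ.dist z A

namespace ApproachDistance

variable {Z : Type u} (δ : ApproachDistance Z)

theorem dist_anti (z : Z) {A B : Set Z} (h : A ⊆ B) : δ.dist z B ≤ δ.dist z A := by
  rw [← Set.union_eq_self_of_subset_left h, δ.dist_union]
  exact min_le_left _ _

/-- The distance to a finite union is the minimum of the distances to its pieces. Finiteness of
`δ.dist z A` excludes the empty union. -/
theorem exists_dist_le_of_subset_biUnion {ι : Type*} (F : Finset ι) (B : ι → Set Z) (z : Z)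
    {A : Set Z} (hA : A ⊆ ⋃ k ∈ F, B k) (hz : δ.dist z A ≠ ∞) :
    ∃ k ∈ F, δ.dist z (B k) ≤ δ.dist z A := by
  classical
  induction F using Finset.induction_on generalizing A with
  | empty =>
    have : A = ∅ := by simpa using hA
    exact absurd (this ▸ δ.dist_empty z) hz
  | insert k F _ ih =>
    by_cases h : δ.dist z (B k) ≤ δ.dist z A
    · exact ⟨k, Finset.mem_insert_self _ _, h⟩
    · have h1 : A ⊆ B k ∪ A \ B k := by simp
      have h2 := δ.dist_anti z h1
      rw [δ.dist_union, min_le_iff] at h2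
      have h3 := h2.resolve_left h
      obtain ⟨j, hj, hj'⟩ := ih (A := A \ B k) (by
        rintro a ⟨ha, hk⟩
        have := hA ha
        simp only [Finset.mem_insert, Set.iUnion_iUnion_eq_or_left, Set.mem_union] at this
        exact this.resolve_left hk) (ne_top_of_le_ne_top hz h3)
      exact ⟨j, Finset.mem_insert_of_mem hj, hj'.trans h3⟩

theorem isRegular_dist (B : Set Z) : δ.IsRegular fun z => δ.dist z B := fun z A => by
  rw [add_comm]
  exact δ.dist_triangle z B A

theorem isRegular_const (c : ℝ≥0∞) : δ.IsRegular fun _ => c := fun z A => by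
  rcases A.eq_empty_or_nonempty with rfl | ⟨a, ha⟩
  · simp [δ.dist_empty]
  · exact (le_iSup₂ (f := fun a (_ : a ∈ A) => c) a ha).trans le_self_add

variable {δ}

theorem IsRegular.const_add {h : Z → ℝ≥0∞} (hh : δ.IsRegular h) (c : ℝ≥0∞) :
    δ.IsRegular fun z => c + h z := fun z A => by
  rcases A.eq_empty_or_nonempty with rfl | hA
  · simp [δ.dist_empty]
  · rw [← ENNReal.add_biSup hA, add_assoc]
    exact add_le_add le_rfl (hh z A)

theorem IsRegular.iSup {ι : Sort*} {h : ι → Z → ℝ≥0∞} (hh : ∀ i, δ.IsRegular (h i)) :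
    δ.IsRegular fun z => ⨆ i, h i z := fun z A =>
  iSup_le fun i => (hh i z A).trans <| by
    exact add_le_add (iSup₂_mono fun a _ => le_iSup (fun i => h i a) i) le_rfl

/-- Split `A` according to which function is smaller: one of the two pieces is as close to `z` as
`A`, and on it the minimum is a single function. -/
theorem IsRegular.inf {g h : Z → ℝ≥0∞} (hg : δ.IsRegular g) (hh : δ.IsRegular h) :
    δ.IsRegular fun z => min (g z) (h z) := fun z A => by
  have hA : A ⊆ (A ∩ {a | g a ≤ h a}) ∪ (A ∩ {a | h a ≤ g a}) := fun a ha =>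
    (le_total (g a) (h a)).imp (⟨ha, ·⟩) (⟨ha, ·⟩)
  have h1 := δ.dist_anti z hA
  rw [δ.dist_union, min_le_iff] at h1
  rcases h1 with h1 | h1
  · refine (min_le_left _ _).trans ((hg z _).trans (add_le_add (iSup₂_le fun a ha => ?_) h1))
    exact le_iSup₂_of_le a ha.1 (le_min le_rfl ha.2)
  · refine (min_le_right _ _).trans ((hh z _).trans (add_le_add (iSup₂_le fun a ha => ?_) h1))
    exact le_iSup₂_of_le a ha.1 (le_min ha.2 le_rfl)

theorem IsRegular.finset_inf {ι : Type*} (F : Finset ι) {h : ι → Z → ℝ≥0∞}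
    (hh : ∀ i, δ.IsRegular (h i)) : δ.IsRegular fun z => F.inf fun i => h i z := by
  classical
  induction F using Finset.induction_on with
  | empty => simpa using δ.isRegular_const ∞
  | insert i F _ ih => simpa using (hh i).inf ih

theorem IsRegular.comp {W : Type u} {δ' : ApproachDistance W} {h : W → ℝ≥0∞}
    (hh : δ'.IsRegular h) {f : Z → W} (hf : IsContraction δ δ' f) : δ.IsRegular (h ∘ f) :=
  fun z A => (hh (f z) (f '' A)).trans <| by
    rw [iSup_image]
    exact add_le_add le_rfl (hf z A)

/-- Regular functions extend along embeddings. -/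
theorem IsRegular.exists_extension {X Y : Type u} {δX : ApproachDistance X}
    {δY : ApproachDistance Y} {e : X → Y}
    (he : ∀ x A, δX.dist x A = δY.dist (e x) (e '' A)) {f : X → ℝ≥0∞} (hf : δX.IsRegular f) :
    ∃ g : Y → ℝ≥0∞, δY.IsRegular g ∧ ∀ x, g (e x) = f x := by
  -- A staircase of step `ε`, capped at `N * ε` so that it is a finite meet of regular functions. If
  -- `f x` lies between `n * ε` and `(n + 1) * ε`, the `n`-th term at `e x` is `n * ε`; regularity
  -- of `f` keeps every term within `ε` of `f x` from below.
  let G (ε : ℝ≥0∞) (N : ℕ) (y : Y) : ℝ≥0∞ := min (N * ε)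
    ((Finset.range N).inf fun n : ℕ => n * ε + δY.dist y (e '' {x | f x ≤ (n + 1) * ε}))
  have hG (ε N) : δY.IsRegular (G ε N) := (δY.isRegular_const _).inf
    (.finset_inf _ fun n => (δY.isRegular_dist _).const_add _)
  refine ⟨fun y => ⨆ ε : {ε : ℝ≥0∞ // 0 < ε}, ⨆ N, G ε N y,
    .iSup fun ε => .iSup fun N => hG ε N, fun x => le_antisymm ?_ ?_⟩
  · refine iSup_le fun ⟨ε, _⟩ => iSup_le fun N => ?_
    rcases le_total (N * ε) (f x) with h | h
    · exact (min_le_left _ _).trans h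
    · have : N = 0 ∨ ∃ n < N, n * ε ≤ f x ∧ f x ≤ (n + 1) * ε := by
        induction N with
        | zero => exact Or.inl rfl
        | succ N ih =>
          rcases le_total (N * ε) (f x) with h' | h'
          · exact Or.inr ⟨N, N.lt_succ_self, h', by exact_mod_cast h⟩
          · rcases ih h' with rfl | ⟨n, hn, hn'⟩
            · exact Or.inr ⟨0, by simp, by simp, h'.trans (by simp)⟩
            · exact Or.inr ⟨n, hn.trans N.lt_succ_self, hn'⟩
      rcases this with rfl | ⟨n, hn, hn1, hn2⟩
      · exact (min_le_left _ _).trans (by simp)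
      · refine (min_le_right _ _).trans ((Finset.inf_le (Finset.mem_range.2 hn)).trans ?_)
        have h3 : δX.dist x {x | f x ≤ (n + 1) * ε} ≤ 0 :=
          (δX.dist_anti x (A := {x}) (by simpa using hn2)).trans (δX.dist_singleton_self x).le
        rwa [← he, nonpos_iff_eq_zero.1 h3, add_zero]
  · refine le_of_forall_lt_imp_le_of_dense fun c hc => ?_
    obtain ⟨b, hcb, hb⟩ := exists_between hc
    have hε : 0 < b - c := tsub_pos_of_lt hcb
    -- With step `b - c`, the error of one step lowers `b` exactly to `c`; `N` is large enough for
    -- the cap to exceed `c`.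
    obtain ⟨N, hN⟩ := ENNReal.exists_nat_mul_gt hε.ne' hc.ne_top
    refine le_iSup_of_le ⟨b - c, hε⟩ (le_iSup_of_le N (le_min hN.le (Finset.le_inf fun n _ => ?_)))
    rw [← he]
    refine (ENNReal.add_le_add_iff_right (a := b - c) (ENNReal.sub_ne_top hb.ne_top)).1 ?_
    rw [add_tsub_cancel_of_le hcb.le]
    refine hb.le.trans ((hf x {x | f x ≤ (n + 1) * (b - c)}).trans ?_)
    rw [add_right_comm, ← add_one_mul]
    exact add_le_add (iSup₂_le fun a ha => ha) le_rfl

end ApproachDistance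

/-! ## Scott weights as regular functions -/

section ScottWeights

variable {X Y Z : Type u} {d : Metric X} {d' : Metric Y} {δ : ApproachDistance Z}

theorem isScottWeight_dist (d : Metric X) (y : X) : IsScottWeight d fun x => d.dist x y where
  weight x x' := by
    rw [add_comm]
    exact d.dist_triangle x x' y
  le_limit _ _ _ _ _ _ _ ha := (ha y).le

theorem IsScottWeight.le_scottDistance {φ : X → ℝ≥0∞} (hφ : IsScottWeight d φ) {A : Set X}
    (hA : ∀ a ∈ A, φ a = 0) (x : X) : φ x ≤ (scottDistance d).dist x A :=
  le_iSup_of_le φ (le_iSup_of_le hφ (le_iSup_of_le hA le_rfl))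

theorem scottDistance_singleton (d : Metric X) (x y : X) :
    (scottDistance d).dist x {y} = d.dist x y := by
  refine le_antisymm (iSup_le fun φ => iSup_le fun hφ => iSup_le fun h => ?_)
    ((isScottWeight_dist d y).le_scottDistance (by simp [d.dist_self]) x)
  simpa [h y rfl] using hφ.weight x y

/-- Subtracting the supremum of `φ` over `A` leaves a Scott weight vanishing on `A`, which competes
in the definition of the Scott distance. -/
theorem IsScottWeight.isRegular {φ : X → ℝ≥0∞} (hφ : IsScottWeight d φ) :
    (scottDistance d).IsRegular φ := fun x A => by
  rw [← tsub_le_iff_left]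
  exact (hφ.tsub _).le_scottDistance
    (fun a ha => tsub_eq_zero_of_le (le_iSup₂ (f := fun a (_ : a ∈ A) => φ a) a ha)) x

/-- This expresses convergence through the distance: regularity tested against the tails of a net is
the limit condition on a Scott weight. -/
theorem scottDistance_eq_zero_of_limit {I : Type u} [Preorder I] [IsDirectedOrder I] [Nonempty I]
    {x : I → X} {a : X} (hx : IsForwardCauchy d x) (ha : IsYonedaLimit d x a) (i : I) :
    (scottDistance d).dist a (x '' Set.Ici i) = 0 := by
  refine le_antisymm (iSup_le fun φ => iSup_le fun hφ => iSup_le fun h => ?_) bot_le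
  refine (hφ.le_limit I x a hx ha).trans (iInf_le_of_le i (iSup₂_le fun j hj => ?_))
  exact (h _ ⟨j, hj, rfl⟩).le

theorem isScottWeight_of_isRegular {φ : X → ℝ≥0∞} (hφ : (scottDistance d).IsRegular φ) :
    IsScottWeight d φ where
  weight x y := by simpa [scottDistance_singleton] using hφ x {y}
  le_limit I _ _ _ x a hx ha := le_iInf fun i => by
    have h := hφ a (x '' Set.Ici i)
    rwa [scottDistance_eq_zero_of_limit hx ha, iSup_image, add_zero] at h

theorem isContraction_scottDistance_iff {f : Z → X} :
    IsContraction δ (scottDistance d) f ↔ ∀ φ, IsScottWeight d φ → δ.IsRegular (φ ∘ f) := by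
  refine ⟨fun hf φ hφ => hφ.isRegular.comp hf, fun h z A => ?_⟩
  refine iSup_le fun φ => iSup_le fun hφ => iSup_le fun hA => ?_
  refine (h φ hφ z A).trans (le_of_eq ?_)
  rw [biSup_congr (f := φ ∘ f) (g := fun _ => 0) fun a ha => hA (f a) ⟨a, ha, rfl⟩]
  simp

theorem IsForwardCauchy.map {I : Type u} [Preorder I] {x : I → X} (hx : IsForwardCauchy d x)
    {f : X → Y} (hf : IsNonexpansive d d' f) : IsForwardCauchy d' fun i => f (x i) :=
  le_antisymm (le_trans (iInf_mono fun _ => iSup_mono fun _ => iSup_mono fun _ => iSup_mono fun _ =>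
    iSup_mono fun _ => hf _ _) (le_of_eq hx)) bot_le

theorem iInf_iSup_le_add {I : Type u} [Preorder I] [IsDirectedOrder I] [Nonempty I]
    {f g : I → ℝ≥0∞} (c : ℝ≥0∞) (h : ∀ i, f i ≤ g i + c) :
    (⨅ i, ⨆ j, ⨆ (_ : i ≤ j), f j) ≤ (⨅ i, ⨆ j, ⨆ (_ : i ≤ j), g j) + c := by
  rw [ENNReal.iInf_add]
  exact iInf_mono fun i => iSup₂_le fun j hj => (h j).trans
    (add_le_add (le_iSup₂ (f := fun j (_ : i ≤ j) => g j) j hj) le_rfl)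

/-- Pulling back the Scott weight `d'.dist · y` gives one inequality of the limit formula; the other
is the triangle inequality, as `d.dist (x j) a` has upper limit `d.dist a a = 0`. -/
theorem isYonedaContinuous_of_isContraction {f : X → Y}
    (hf : IsContraction (scottDistance d) (scottDistance d') f) : IsYonedaContinuous d d' f := by
  have hne : IsNonexpansive d d' f := fun x y => by
    simpa [scottDistance_singleton] using hf x {y}
  refine ⟨hne, fun I _ _ _ x a hx ha y => le_antisymm ?_ ?_⟩
  · exact (isScottWeight_of_isRegular (isContraction_scottDistance_iff.1 hf _
      (isScottWeight_dist d' y))).le_limit I x a hx ha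
  · calc (⨅ i, ⨆ j, ⨆ (_ : i ≤ j), d'.dist (f (x j)) y)
      _ ≤ (⨅ i, ⨆ j, ⨆ (_ : i ≤ j), d.dist (x j) a) + d'.dist (f a) y :=
        iInf_iSup_le_add _ fun i => (d'.dist_triangle _ (f a) _).trans
          (add_le_add (hne _ _) le_rfl)
      _ = d'.dist (f a) y := by rw [← ha a, d.dist_self, zero_add]

end ScottWeights

/-! ## Powers of `[0, ∞]` -/

section Powers

variable {K : Type u}

/-- The sup-metric on a power of `([0, ∞], d_R)`. -/
noncomputable def dRMetric (K : Type u) : Metric (K → ℝ≥0∞) := (dRPower K).metric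

theorem dRMetric_dist_le_iff {x y : K → ℝ≥0∞} {c : ℝ≥0∞} :
    (dRMetric K).dist x y ≤ c ↔ ∀ k, x k ≤ c + y k := by
  simp [dRMetric, dRPower, dR, iSup_le_iff]

/-- Powers of `([0, ∞], d_R)` are Yoneda complete. -/
theorem isYonedaLimit_dRMetric {I : Type u} [Preorder I] [IsDirectedOrder I] [Nonempty I]
    {x : I → K → ℝ≥0∞} (hx : IsForwardCauchy (dRMetric K) x) :
    IsYonedaLimit (dRMetric K) x fun k => ⨅ i, ⨆ j, ⨆ (_ : i ≤ j), x j k := by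
  intro y
  refine le_antisymm (dRMetric_dist_le_iff.2 fun k => iInf_iSup_le_add _ fun i =>
    dRMetric_dist_le_iff.1 le_rfl k) ?_
  refine ENNReal.le_of_forall_pos_le_add fun ε hε _ => ?_
  have h0 : (⨅ i, ⨆ j, ⨆ (_ : i ≤ j), ⨆ k, ⨆ (_ : j ≤ k), (dRMetric K).dist (x j) (x k))
      < ε := lt_of_eq_of_lt hx (by simpa using hε)
  obtain ⟨i, hi⟩ := iInf_lt_iff.1 h0
  refine iInf_le_of_le i (iSup₂_le fun j hj => dRMetric_dist_le_iff.2 fun k => ?_)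
  -- The bound by `ε` is uniform in `k`, so the coordinatewise upper limit is a limit for the
  -- sup-metric.
  have h1 : x j k ≤ (⨅ i, ⨆ j, ⨆ (_ : i ≤ j), x j k) + ε := by
    rw [ENNReal.iInf_add]
    refine le_iInf fun l => ?_
    obtain ⟨m, hjm, hlm⟩ := exists_ge_ge j l
    have h2 : (dRMetric K).dist (x j) (x m) ≤ ε :=
      le_trans (le_trans (le_iSup₂_of_le m hjm le_rfl) (le_iSup₂ (f := fun j (_ : i ≤ j) =>
        ⨆ k, ⨆ (_ : j ≤ k), (dRMetric K).dist (x j) (x k)) j hj)) hi.le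
    refine (dRMetric_dist_le_iff.1 h2 k).trans ?_
    rw [add_comm]
    exact add_le_add (le_iSup₂ (f := fun j (_ : l ≤ j) => x j k) m hlm) le_rfl
  refine h1.trans ?_
  rw [add_right_comm]
  exact add_le_add (dRMetric_dist_le_iff.1 le_rfl k) le_rfl

theorem isScottWeight_eval (k : K) : IsScottWeight (dRMetric K) fun x => x k where
  weight x y := by
    rw [add_comm]
    exact dRMetric_dist_le_iff.1 le_rfl k
  le_limit I _ _ _ x a hx ha := by
    have h := isYonedaLimit_dRMetric hx
    -- Two Yoneda limits of one net are at distance zero, so `a` lies coordinatewise below the upper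
    -- limit.
    have h1 := (ha fun k => ⨅ i, ⨆ j, ⨆ (_ : i ≤ j), x j k).trans (h _).symm
    rw [(dRMetric K).dist_self] at h1
    simpa using dRMetric_dist_le_iff.1 h1.le k

/-- Points of finite support that approximate `x` from below. -/
def FiniteApprox (x : K → ℝ≥0∞) : Type u :=
  {u : K → ℝ≥0∞ // (Function.support u).Finite ∧ ∀ k, u k = 0 ∨ u k < x k}

namespace FiniteApprox

variable (x : K → ℝ≥0∞)

instance : PartialOrder (FiniteApprox x) := inferInstanceAs (PartialOrder (Subtype _))

instance : Nonempty (FiniteApprox x) := ⟨⟨0, by simp, fun _ => Or.inl rfl⟩⟩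

instance : IsDirectedOrder (FiniteApprox x) where
  directed u v := by
    refine ⟨⟨u.1 ⊔ v.1, (u.2.1.union v.2.1).subset (Function.support_sup u.1 v.1),
      fun k => ?_⟩, ?_, ?_⟩
    · rcases le_total (u.1 k) (v.1 k) with h | h
      · simpa [h] using v.2.2 k
      · simpa [h] using u.2.2 k
    · exact (le_sup_left : u.1 ≤ u.1 ⊔ v.1)
    · exact (le_sup_right : v.1 ≤ u.1 ⊔ v.1)

variable {x}

theorem le (u : FiniteApprox x) : u.1 ≤ x := fun k =>
  (u.2.2 k).elim (fun h => h.trans_le bot_le) le_of_lt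

theorem exists_eq {k : K} {c : ℝ≥0∞} (hc : c < x k) : ∃ u : FiniteApprox x, u.1 k = c := by
  classical
  refine ⟨⟨Pi.single k c, (Set.finite_singleton k).subset (Pi.support_single_subset), fun l => ?_⟩,
    by simp⟩
  rcases eq_or_ne l k with rfl | h
  · simp [hc]
  · simp [h]

/-- The net is increasing, and `u ≤ v` forces distance zero from `u` to `v`. -/
theorem isForwardCauchy : IsForwardCauchy (dRMetric K) fun u : FiniteApprox x => u.1 := by
  refine le_antisymm (iInf_le_of_le (Classical.arbitrary _) ?_) bot_le
  refine iSup₂_le fun u _ => iSup₂_le fun v huv => dRMetric_dist_le_iff.2 fun k => ?_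
  simpa using huv k

theorem isYonedaLimit : IsYonedaLimit (dRMetric K) (fun u : FiniteApprox x => u.1) x := by
  convert isYonedaLimit_dRMetric isForwardCauchy (x := fun u : FiniteApprox x => u.1) with k
  refine le_antisymm (le_iInf fun u => le_of_forall_lt_imp_le_of_dense fun c hc => ?_)
    (iInf_le_of_le (Classical.arbitrary _) (iSup₂_le fun u _ => FiniteApprox.le u k))
  obtain ⟨v, rfl⟩ := exists_eq hc
  obtain ⟨w, huw, hvw⟩ := exists_ge_ge u v
  exact le_iSup₂_of_le w huw (hvw k)

end FiniteApprox

/-- The Scott distance of a power of `[0, ∞]` is that of the product of approach spaces. -/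
theorem isContraction_dRMetric_iff {Z : Type u} {δ : ApproachDistance Z} {f : Z → K → ℝ≥0∞} :
    IsContraction δ (scottDistance (dRMetric K)) f ↔
      ∀ k, δ.IsRegular fun z => f z k := by
  rw [isContraction_scottDistance_iff]
  refine ⟨fun h k => h _ (isScottWeight_eval k), fun h φ hφ z A => ?_⟩
  refine le_of_forall_lt_imp_le_of_dense fun c hc => ?_
  -- The point `f z` is replaced by some `u` of finite support with `c < φ u`. If the claim failed,
  -- no `f a` with `a ∈ A` could be within `δ.dist z A` of `u`, so each `a` would violate the bound
  -- at a coordinate in the support. This covers `A` by finitely many sets, one of them as close to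
  -- `z` as `A`.
  obtain ⟨u, hu⟩ := hφ.eventually_lt FiniteApprox.isForwardCauchy FiniteApprox.isYonedaLimit hc
  have hu := hu u le_rfl
  by_contra! hlt
  have htop : δ.dist z A ≠ ∞ := fun h => by simp [h] at hlt
  obtain ⟨k, -, hk⟩ := δ.exists_dist_le_of_subset_biUnion u.2.1.toFinset
    (fun k => {a | f a k + δ.dist z A < u.1 k}) z (A := A) (fun a ha => by
      by_contra hna
      simp only [Set.mem_iUnion, not_exists, Set.mem_ofPred_eq, not_lt] at hna
      have h1 : (dRMetric K).dist u.1 (f a) ≤ δ.dist z A :=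
        dRMetric_dist_le_iff.2 fun k => by
          by_cases h0 : u.1 k = 0
          · simp [h0]
          · rw [add_comm]
            exact hna k (by simpa using h0)
      have h2 : φ u.1 ≤ (⨆ a ∈ A, (φ ∘ f) a) + δ.dist z A := (hφ.weight _ _).trans
        (add_le_add (le_iSup₂ (f := fun a (_ : a ∈ A) => (φ ∘ f) a) a ha) h1)
      exact absurd (hu.trans_le h2) hlt.not_gt) htop
  generalize hB : {a | f a k + δ.dist z A < u.1 k} = B at hk
  rcases B.eq_empty_or_nonempty with rfl | ⟨b, hb⟩
  · rw [δ.dist_empty] at hk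
    exact htop (top_le_iff.1 hk)
  · have hsup : (⨆ a ∈ B, f a k) + δ.dist z A ≤ u.1 k := by
      rw [ENNReal.biSup_add ⟨b, hb⟩]
      exact iSup₂_le fun a ha => by
        rw [← hB] at ha
        exact le_of_lt ha
    have h3 : f z k ≤ u.1 k := ((h k z B).trans (add_le_add le_rfl hk)).trans hsup
    -- Regularity of coordinate `k` gave `f z k ≤ u.1 k`, against the strict approximation `u.1 k <
    -- f z k`; a zero value of `u` is excluded because the piece is nonempty.
    rcases u.2.2 k with h4 | h4
    · rw [← hB] at hb
      simp [h4] at hb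
    · exact absurd h4 h3.not_gt

end Powers

/-! ## Retracts of powers and injective approach spaces -/

theorem eq_of_dRMetric_dist {K : Type u} {x y : K → ℝ≥0∞}
    (h : (dRMetric K).dist x y = 0) (h' : (dRMetric K).dist y x = 0) : x = y :=
  funext fun k => le_antisymm (by simpa using dRMetric_dist_le_iff.1 h.le k)
    (by simpa using dRMetric_dist_le_iff.1 h'.le k)

theorem isInjectiveT0_sigma_dRPower (K : Type u) :
    IsInjectiveT0 (SigmaFunctor.obj (dRPower K)) := by
  refine ⟨fun x y h h' => ?_, fun X Y e f he => ?_⟩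
  · exact eq_of_dRMetric_dist ((scottDistance_singleton (dRMetric K) x y).symm.trans h)
      ((scottDistance_singleton (dRMetric K) y x).symm.trans h')
  · choose g hg hge using fun k =>
      (isContraction_dRMetric_iff.1 f.2 k).exists_extension (δY := Y.approach) he
    exact ⟨⟨fun y k => g k y, isContraction_dRMetric_iff.2 hg⟩,
      Subtype.ext (funext fun x => funext fun k => hge k x)⟩

theorem IsInjectiveT0.of_retract {W Z : App.{u}} (r : Retract W Z) (hZ : IsInjectiveT0 Z) :
    IsInjectiveT0 W := by
  have hr (w) : r.r.1 (r.i.1 w) = w := congrFun (congrArg Subtype.val r.retract) w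
  refine ⟨fun x y h h' => ?_, fun X Y e f he => ?_⟩
  · have hi (x y) (h : W.approach.dist x {y} = 0) :
        Z.approach.dist (r.i.1 x) {r.i.1 y} = 0 :=
      le_antisymm (by simpa [h] using r.i.2 x {y}) bot_le
    rw [← hr x, hZ.1 _ _ (hi x y h) (hi y x h'), hr]
  · obtain ⟨g, hg⟩ := hZ.2 X Y e (f ≫ r.i) he
    exact ⟨g ≫ r.r, by rw [← Category.assoc, hg, Category.assoc, r.retract, Category.comp_id]⟩

theorem IsRetractOfPower.isInjectiveT0_sigma {X : MetUp.{u}} (hX : IsRetractOfPower X) :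
    IsInjectiveT0 (SigmaFunctor.obj X) := by
  obtain ⟨K, ⟨r⟩⟩ := hX
  exact .of_retract (r.map SigmaFunctor) (isInjectiveT0_sigma_dRPower K)

/-- Every approach space embeds canonically into a power of `[0, ∞]`. -/
theorem exists_isEmbedding_dRPower (Z : App.{u}) :
    ∃ (K : Type u) (s : Z ⟶ SigmaFunctor.obj (dRPower K)), IsEmbedding s := by
  let s (z : Z.carrier) (h : {h : Z.carrier → ℝ≥0∞ // Z.approach.IsRegular h}) : ℝ≥0∞ := h.1 z
  have hs : IsContraction Z.approach (scottDistance (dRMetric _)) s :=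
    isContraction_dRMetric_iff.2 fun h => h.2
  refine ⟨_, ⟨s, hs⟩, fun z A => le_antisymm ?_ (hs z A)⟩
  -- The coordinate indexed by the regular function `δ(·, A)` vanishes on `s '' A` and takes the
  -- value `δ(z, A)` at `s z`.
  refine (isScottWeight_eval ⟨_, Z.approach.isRegular_dist A⟩).le_scottDistance ?_ (s z)
  rintro _ ⟨a, ha, rfl⟩
  exact le_antisymm ((Z.approach.dist_anti a (Set.singleton_subset_iff.2 ha)).trans
    (Z.approach.dist_singleton_self a).le) bot_le

theorem IsInjectiveT0.exists_retract {Z : App.{u}} (hZ : IsInjectiveT0 Z) :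
    ∃ K : Type u, Nonempty (Retract Z (SigmaFunctor.obj (dRPower K))) := by
  obtain ⟨K, s, hs⟩ := exists_isEmbedding_dRPower Z
  obtain ⟨r, hr⟩ := hZ.2 _ _ s (𝟙 Z) hs
  exact ⟨K, ⟨⟨s, r, hr⟩⟩⟩

/-- Both the section and the retraction contract, so the section is an embedding. -/
theorem dist_eq_of_retract {W Z : App.{u}} (r : Retract W Z) (x : W.carrier) (A : Set W.carrier) :
    W.approach.dist x A = Z.approach.dist (r.i.1 x) (r.i.1 '' A) := by
  refine le_antisymm ?_ (r.i.2 x A)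
  have hr : r.r.1 ∘ r.i.1 = id := congrArg Subtype.val r.retract
  have h := r.r.2 (r.i.1 x) (r.i.1 '' A)
  rw [← Set.image_comp, hr, Set.image_id] at h
  exact (congrArg (W.approach.dist · A) (congrFun hr x)).ge.trans h

/-! ### Splitting Yoneda continuous idempotents on powers -/

section Splitting

variable {W K : Type u} {d : Metric W} {s : W → K → ℝ≥0∞} {r : (K → ℝ≥0∞) → W}

/-- The net `s (x i)` has a limit in the power and is fixed by `s ∘ r`, so it also has a limit of
the form `s b`. Since `s` is isometric, `b` is a limit of `x`, and `T_0` separation gives `b = a`.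
-/
theorem isYonedaContinuous_section (hT0 : ∀ x y, d.dist x y = 0 → d.dist y x = 0 → x = y)
    (hr : ∀ w, r (s w) = w) (hs : ∀ x y, d.dist x y = (dRMetric K).dist (s x) (s y))
    (he : IsYonedaContinuous (dRMetric K) (dRMetric K) (s ∘ r)) :
    IsYonedaContinuous d (dRMetric K) s where
  nonexpansive x y := (hs x y).ge
  map_limit I _ _ _ x a hx ha := by
    have hsx : IsForwardCauchy (dRMetric K) fun i => s (x i) := hx.map fun x y => (hs x y).ge
    have hlim := he.map_limit I _ _ hsx (isYonedaLimit_dRMetric hsx)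
    simp only [Function.comp_apply, hr] at hlim
    generalize r _ = b at hlim
    have hab (y) : d.dist a y = d.dist b y := by
      rw [ha y, hs b y, hlim (s y)]
      simp only [hs]
    obtain rfl : a = b := hT0 a b ((hab b).trans (d.dist_self b))
      ((hab a).symm.trans (d.dist_self a))
    exact hlim

theorem isYonedaContinuous_retraction (hs : ∀ x y, d.dist x y = (dRMetric K).dist (s x) (s y))
    (he : IsYonedaContinuous (dRMetric K) (dRMetric K) (s ∘ r)) :
    IsYonedaContinuous (dRMetric K) d r where
  nonexpansive x y := (hs _ _).trans_le (he.nonexpansive x y)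
  map_limit I _ _ _ x a hx ha w := by
    simpa only [hs, Function.comp_apply] using he.map_limit I x a hx ha (s w)

end Splitting

/-- An approach space with its specialization metric. -/
def specialization (Z : App.{u}) : MetUp.{u} := ⟨Z.carrier, (OmegaFunctor.obj Z).metric⟩

/-- A retraction of a power of `[0, ∞]` onto `Z` in `App` is one in `Met^↑` onto the
specialization metric of `Z`. -/
def retractSpecialization {Z : App.{u}} (hZ : IsT0 Z) {K : Type u}
    (r : Retract Z (SigmaFunctor.obj (dRPower K))) : Retract (specialization Z) (dRPower K) :=
  have hr (w) : r.r.1 (r.i.1 w) = w := congrFun (congrArg Subtype.val r.retract) w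
  have hs (x y : Z.carrier) :
      (specialization Z).metric.dist x y = (dRMetric K).dist (r.i.1 x) (r.i.1 y) :=
    (dist_eq_of_retract r x {y}).trans ((congrArg
      (fun A => (scottDistance (dRMetric K)).dist (r.i.1 x) A) (Set.image_singleton ..)).trans
        (scottDistance_singleton _ _ _))
  have he : IsYonedaContinuous (dRMetric K) (dRMetric K) (r.i.1 ∘ r.r.1) :=
    isYonedaContinuous_of_isContraction (r.r ≫ r.i).2
  { i := ⟨r.i.1, isYonedaContinuous_section hZ hr hs he⟩
    r := ⟨r.r.1, isYonedaContinuous_retraction hs he⟩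
    retract := Subtype.ext (funext hr) }

theorem IsInjectiveT0.isRetractOfPower_specialization {Z : App.{u}} (hZ : IsInjectiveT0 Z) :
    IsRetractOfPower (specialization Z) := by
  obtain ⟨K, ⟨r⟩⟩ := hZ.exists_retract
  exact ⟨K, ⟨retractSpecialization hZ.1 r⟩⟩

/-- Both distances are induced from the Scott distance of the power along the same map `r.i`. -/
theorem IsInjectiveT0.scottDistance_specialization {Z : App.{u}} (hZ : IsInjectiveT0 Z) :
    scottDistance (specialization Z).metric = Z.approach := by
  obtain ⟨K, ⟨r⟩⟩ := hZ.exists_retract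
  ext x A
  exact (dist_eq_of_retract ((retractSpecialization hZ.1 r).map SigmaFunctor) x A).trans
    (dist_eq_of_retract r x A).symm

theorem specialization_sigma (X : MetUp.{u}) : specialization (SigmaFunctor.obj X) = X := by
  obtain ⟨X, d⟩ := X
  refine congrArg (MetUp.mk X) (Metric.ext (funext fun x => funext fun y => ?_))
  exact scottDistance_singleton d x y

theorem IsInjectiveT0.sigma_specialization {Z : App.{u}} (hZ : IsInjectiveT0 Z) :
    SigmaFunctor.obj (specialization Z) = Z :=
  congrArg (App.mk Z.carrier) hZ.scottDistance_specialization

/-! ## The two functors -/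

/-- The restriction of `Σ`. -/
noncomputable def sigmaRestrict : RetrMet.{u} ⥤ InjApp.{u} :=
  IsInjectiveT0.lift (IsRetractOfPower.ι ⋙ SigmaFunctor) fun X => X.2.isInjectiveT0_sigma

/-- Contractions between injective `T_0` approach spaces are Yoneda continuous. -/
theorem isYonedaContinuous_specialization {Z W : App.{u}} (hZ : IsInjectiveT0 Z)
    (hW : IsInjectiveT0 W) (f : Z ⟶ W) :
    IsYonedaContinuous (specialization Z).metric (specialization W).metric f.1 := by
  refine isYonedaContinuous_of_isContraction ?_
  rw [hZ.scottDistance_specialization, hW.scottDistance_specialization]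
  exact f.2

/-- The restriction of `Ω`. -/
def omegaRestrict : InjApp.{u} ⥤ RetrMet.{u} :=
  IsRetractOfPower.lift
    { obj := fun Z : InjApp.{u} => specialization Z.obj
      map := fun {Z W} f => ⟨f.hom.1, isYonedaContinuous_specialization Z.2 W.2 f.hom⟩ }
    fun Z => Z.2.isRetractOfPower_specialization

/-- The round trips preserve objects only up to propositional equality, so morphisms are compared
through their underlying functions. -/
theorem RetrMet.hom_heq {X X' Y Y' : RetrMet.{u}} (hX : X = X') (hY : Y = Y') {f : X ⟶ Y}
    {f' : X' ⟶ Y'} (h : f.hom.1 ≍ f'.hom.1) : f ≍ f' := by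
  subst hX hY
  exact heq_of_eq (InducedCategory.hom_ext (Subtype.ext (eq_of_heq h)))

theorem InjApp.hom_heq {X X' Y Y' : InjApp.{u}} (hX : X = X') (hY : Y = Y') {f : X ⟶ Y}
    {f' : X' ⟶ Y'} (h : f.hom.1 ≍ f'.hom.1) : f ≍ f' := by
  subst hX hY
  exact heq_of_eq (InducedCategory.hom_ext (Subtype.ext (eq_of_heq h)))

theorem omegaRestrict_sigmaRestrict_obj (X : RetrMet.{u}) :
    (sigmaRestrict ⋙ omegaRestrict).obj X = X := by
  obtain ⟨X, hX⟩ := X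
  exact ObjectProperty.FullSubcategory.ext (specialization_sigma X)

theorem sigmaRestrict_omegaRestrict_obj (Z : InjApp.{u}) :
    (omegaRestrict ⋙ sigmaRestrict).obj Z = Z := by
  obtain ⟨Z, hZ⟩ := Z
  exact ObjectProperty.FullSubcategory.ext hZ.sigma_specialization

end ScottApproach

/-- `Σ` and `Ω` (co)restrict to mutually inverse functors between the full subcategory of `Met^↑`
of retracts of powers of `([0, ∞], d_R)` and the category of injective `T_0` approach spaces. -/
theorem mainTheorem5 :
    ∃ (S : ScottApproach.RetrMet.{u} ⥤ ScottApproach.InjApp.{u})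
      (O : ScottApproach.InjApp.{u} ⥤ ScottApproach.RetrMet.{u}),
      S ⋙ ScottApproach.IsInjectiveT0.{u}.ι =
        ScottApproach.IsRetractOfPower.{u}.ι ⋙ ScottApproach.SigmaFunctor.{u} ∧
      O ⋙ ScottApproach.IsRetractOfPower.{u}.ι ⋙ ScottApproach.metUpToMet.{u} =
        ScottApproach.IsInjectiveT0.{u}.ι ⋙ ScottApproach.OmegaFunctor.{u} ∧
      S ⋙ O = 𝟭 ScottApproach.RetrMet.{u} ∧
      O ⋙ S = 𝟭 ScottApproach.InjApp.{u} :=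
  ⟨ScottApproach.sigmaRestrict, ScottApproach.omegaRestrict, rfl, rfl,
    -- Neither functor changes carriers or underlying maps, so the functions agree definitionally.
    Functor.hext ScottApproach.omegaRestrict_sigmaRestrict_obj fun X Y _ =>
      ScottApproach.RetrMet.hom_heq (ScottApproach.omegaRestrict_sigmaRestrict_obj X)
        (ScottApproach.omegaRestrict_sigmaRestrict_obj Y) HEq.rfl,
    Functor.hext ScottApproach.sigmaRestrict_omegaRestrict_obj fun X Y _ =>
      ScottApproach.InjApp.hom_heq (ScottApproach.sigmaRestrict_omegaRestrict_obj X)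
        (ScottApproach.sigmaRestrict_omegaRestrict_obj Y) HEq.rfl⟩
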